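/- Let $M=(E,\rho)$ be a matroid without loops on a finite set $E$ with $m=\#E$ elements, with rank function $\rho$, and of rank $d=\rho(E)\ge 1$. Let $$T_M(x,y)=\sum_{S\subseteq E}(x-1)^{\rho(E)-\rho(S)}(y-1)^{\#S-\rho(S)}$$ be its Tutte polynomial, put $$Y_M(q,t)=(1-q)^{d}\,q^{m-d}\,T_M\!\left(\frac{qt+1-q}{1-q},\frac1q\right),\qquad \widehat Y_M(p,t)=\frac{(-1)^{d}\,Y_M(1+p,-t)-t^{d}}{1+t}\in\mathbb{Z}(p,t).$$ For $0\le i\le d-1$ let $\mathcal S_i^M$ be the set of all $S\subseteq E$ with $\rho(S)\ge d-i$, ordered by inclusion, let $\mathcal L_i^M=\{\widehat 0\}\oplus\mathcal S_i^M$ be obtained from it by adjoining a new least element $\widehat 0$, let $\mu_i^M$ be the Möbius function of $\mathcal L_i^M$, and for $1\le j\le m-d+1+i$ let $$\omega_j^{i,M}=(-1)^j\sum_{S\in\mathcal S_i^M,\ \#S-d+1+i=j}\mu_i^M(\widehat 0,S).$$ For a partial order $P$ with least element $\widehat 0$ and $k\ge 0$, let $$WH_k(P;\mathbb Z)=\bigoplus_{\widehat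 0<\sigma\in P}\widetilde H_{k-1}\big(\Delta([\widehat 0,\sigma]);\mathbb Z\big)$$ be its Whitney homology, where $\Delta([\widehat 0,\sigma])$ is the simplicial complex of finite chains of the open interval $(\widehat 0,\sigma)$ and $\widetilde H$ is reduced simplicial homology (so that $\widetilde H_{-1}(\Delta;\mathbb Z)=\mathbb Z$ if $\Delta$ has no vertices). Then $\widehat Y_M(p,t)$ is a polynomial in $\mathbb Z[p,t]$, and for all $0\le i\le d-1$ and $1\le j\le m-d+1+i$ its coefficients satisfy $$[p^{d-1-i+j}t^i]\,\widehat Y_M(p,t)=\omega_j^{i,M}=\operatorname{rank} WH_{j-1}(\mathcal L_i^M;\mathbb Z).$$ -/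

import Mathlib

namespace TutteWhitney

open scoped DirectSum Polynomial

/-! ### Rank functions and the Tutte polynomial -/

section Matroids

variable {α : Type*} (M : Matroid α)

/-- The rank `ρ(S)` of a set `S`, as a natural number. -/
noncomputable def rk (S : Set α) : ℕ := (M.eRk S).toNat

/-- The rank `d(M) = ρ(E)` of the matroid. -/
noncomputable def rank : ℕ := rk M M.E

/-- The corank `σ(S) = #S - ρ(S)` of a finite set `S`. -/
noncomputable def corank (S : Finset α) : ℕ := S.card - rk M (S : Set α)

variable [M.Finite]

/-- The ground set of a finite matroid as a `Finset`. -/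
noncomputable def ground : Finset α := M.ground_finite.toFinset

/-- The Tutte polynomial
`T_M(x, y) = ∑_{S ⊆ E} (x - 1) ^ (ρ(E) - ρ(S)) * (y - 1) ^ σ(S)`; here `x = X 0`, `y = X 1`. -/
noncomputable def tuttePolynomial : MvPolynomial (Fin 2) ℤ :=
  ∑ S ∈ (ground M).powerset,
    (MvPolynomial.X 0 - 1) ^ (rank M - rk M (S : Set α)) * (MvPolynomial.X 1 - 1) ^ corank M S

/-- `Y_M(q, t) = (1 - q) ^ ρ(E) * q ^ σ(E) * T_M((q t + 1 - q) / (1 - q), 1 / q)`, at elements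
`q`, `t` of a field (used below only where `q ≠ 0` and `1 - q ≠ 0`). -/
noncomputable def Y {K : Type*} [Field K] (q t : K) : K :=
  (1 - q) ^ rank M * q ^ corank M (ground M) *
    MvPolynomial.aeval ![(q * t + 1 - q) / (1 - q), 1 / q] (tuttePolynomial M)

/-- The field `ℤ(p, t)` of rational functions, as the fraction field of `ℤ[p][t]`:
the inner variable is `p`, the outer one is `t`. -/
abbrev RatPT : Type := FractionRing ℤ[X][X]

/-- The variable `p` of `ℤ(p, t)`. -/
noncomputable def pVar : RatPT := algebraMap ℤ[X][X] RatPT (Polynomial.C Polynomial.X)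

/-- The variable `t` of `ℤ(p, t)`. -/
noncomputable def tVar : RatPT := algebraMap ℤ[X][X] RatPT Polynomial.X

/-- The rational function
`Ŷ_M(p, t) = ((-1) ^ d(M) * Y_M(1 + p, -t) - t ^ d(M)) / (1 + t)`. -/
noncomputable def Yhat : RatPT :=
  ((-1) ^ rank M * Y M (1 + pVar) (-tVar) - tVar ^ rank M) / (1 + tVar)

end Matroids

/-! ### Möbius function and Whitney homology of a partial order -/

section Posets

open Classical in
/-- The Möbius function of a finite partial order. -/
noncomputable def mobius (P : Type*) [PartialOrder P] [Finite P] (a b : P) : ℤ :=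
  letI : Fintype P := Fintype.ofFinite P
  letI : LocallyFiniteOrder P := Fintype.toLocallyFiniteOrder
  IncidenceAlgebra.mu ℤ a b

variable (Q : Type*) [PartialOrder Q]

/-- The free abelian group on the chains `x₀ < ⋯ < xₙ₋₁` with `n` elements in `Q`, that is, on the
simplices of dimension `n - 1` of the complex of all finite chains of `Q`, each oriented by the
order of `Q`.  For `n = 0` it is freely generated by the empty simplex. -/
abbrev Chains (n : ℕ) : Type _ := (Fin n ↪o Q) →₀ ℤ

/-- The simplicial boundary
`∂ (x₀ < ⋯ < xₙ) = ∑ i, (-1) ^ i (x₀ < ⋯ < x̂ᵢ < ⋯ < xₙ)`; for `n = 0` it is the augmentation. -/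
noncomputable def boundary (n : ℕ) : Chains Q (n + 1) →ₗ[ℤ] Chains Q n :=
  Finsupp.linearCombination ℤ fun c : Fin (n + 1) ↪o Q =>
    ∑ i : Fin (n + 1), Finsupp.single ((Fin.succAboveOrderEmb i).trans c) ((-1 : ℤ) ^ (i : ℕ))

/-- The reduced cycles of dimension `n - 1`. -/
noncomputable def cycles : (n : ℕ) → Submodule ℤ (Chains Q n)
  | 0 => ⊤
  | n + 1 => LinearMap.ker (boundary Q n)

/-- The boundaries of dimension `n - 1`. -/
noncomputable def boundaries (n : ℕ) : Submodule ℤ (Chains Q n) :=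
  LinearMap.range (boundary Q n)

theorem boundary_single (n : ℕ) (c : Fin (n + 1) ↪o Q) (a : ℤ) :
    boundary Q n (Finsupp.single c a) =
      ∑ i : Fin (n + 1),
        Finsupp.single ((Fin.succAboveOrderEmb i).trans c) (a * (-1 : ℤ) ^ (i : ℕ)) := by
  simp [boundary, Finsupp.linearCombination_single, Finset.smul_sum]

/-- Boundaries are cycles, `∂ ∘ ∂ = 0`. -/
theorem boundaries_le_cycles (n : ℕ) : boundaries Q n ≤ cycles Q n := by
  cases n with
  | zero => exact le_top
  | succ n =>
    refine LinearMap.range_le_ker_iff.2 (Finsupp.lhom_ext fun c a => ?_)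
    simp only [LinearMap.comp_apply, boundary_single, map_sum, LinearMap.zero_apply]
    rw [← Fintype.sum_prod_type']
    refine Finset.sum_involution (fun x _ => (x.1.succAbove x.2, x.2.predAbove x.1))
      ?_ ?_ (fun _ _ => Finset.mem_univ _) ?_
    · rintro ⟨i, j⟩ -
      have h : (Fin.succAboveOrderEmb (j.predAbove i)).trans
          ((Fin.succAboveOrderEmb (i.succAbove j)).trans c) =
          (Fin.succAboveOrderEmb j).trans ((Fin.succAboveOrderEmb i).trans c) := by
        ext k
        simp [Fin.succAbove_succAbove_succAbove_predAbove]
      simp only [h]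
      rw [← Finsupp.single_add, mul_assoc, mul_assoc, ← pow_add, ← pow_add,
        Fin.neg_one_pow_succAbove_add_predAbove]
      simp
    · rintro ⟨i, j⟩ - - h
      exact Fin.succAbove_ne i j (congrArg Prod.fst h)
    · rintro ⟨i, j⟩ -
      simp [Fin.succAbove_succAbove_predAbove, Fin.predAbove_predAbove_succAbove]

/-- The reduced integral simplicial homology group `H̃ₙ₋₁` of the complex of all finite chains
of `Q`.  The degree is shifted by one: the argument `n` is the number of vertices. -/
abbrev ReducedHomology (n : ℕ) : Type _ :=
  cycles Q n ⧸ (boundaries Q n).submoduleOf (cycles Q n)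

/-- The Whitney homology
`WH_k(P; ℤ) = ⨁_{σ > ⊥} H̃_{k - 1}(Δ([⊥, σ]); ℤ)` of a partial order with least element `⊥`.
The order complex `Δ([⊥, σ])` consists of the chains of `[⊥, σ]` without its two end points. -/
abbrev WhitneyHomology (P : Type*) [PartialOrder P] [OrderBot P] (k : ℕ) : Type _ :=
  ⨁ σ : {σ : P // ⊥ < σ}, ReducedHomology (Set.Ioo (⊥ : P) (σ : P)) k

end Posets

/-! ### The lattices of sets of large rank -/

section Lattices

variable {α : Type*} (M : Matroid α)

/-- The collection of all `S ⊆ E` with `ρ(S) ≥ d(M) - i`, ordered by inclusion. -/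
abbrev LargeSets (i : ℕ) : Type _ :=
  {S : Finset α // (S : Set α) ⊆ M.E ∧ rank M ≤ rk M (S : Set α) + i}

/-- `LargeSets M i` with a new least element adjoined. -/
abbrev L (i : ℕ) : Type _ := WithBot (LargeSets M i)

instance [M.Finite] (i : ℕ) : Finite (LargeSets M i) :=
  Set.Finite.subset (ground M).powerset.finite_toSet fun S hS => by
    simpa [ground, Finset.subset_iff, Set.subset_def] using hS.1

instance [M.Finite] (i : ℕ) : Finite (L M i) := inferInstanceAs (Finite (Option (LargeSets M i)))

open Classical in
/-- The proper unsigned Whitney number of the first kind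
`ω_j = (-1) ^ j * ∑ μ(⊥, S)`, the sum over all `S` in `LargeSets M i` of height
`#S - d(M) + 1 + i = j`. -/
noncomputable def whitneyNumber [M.Finite] (i j : ℕ) : ℤ :=
  letI : Fintype (LargeSets M i) := Fintype.ofFinite _
  (-1) ^ j * ∑ S : LargeSets M i with S.1.card + 1 + i = j + rank M,
    mobius (L M i) ⊥ (S : L M i)

end Lattices

end TutteWhitney

namespace TutteWhitney

open scoped DirectSum Polynomial

/-! ### Simplicial complexes on a totally ordered set of vertices -/

section Complexes

variable {V : Type*} (lt : V → V → Prop) [DecidableRel lt]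

/-- The sign `(-1) ^ k`, where `k` is the number of elements of `s` preceding `x`. -/
def sgn (x : V) (s : Finset V) : ℤ := (-1) ^ (s.filter (lt · x)).card

theorem sgn_mul_self (x : V) (s : Finset V) : sgn lt x s * sgn lt x s = 1 := by
  simp [sgn, ← mul_pow]

theorem map_mem_of_mem_supported {S : Set (Finset V)} {W : Submodule ℤ (Finset V →₀ ℤ)}
    (f : (Finset V →₀ ℤ) →ₗ[ℤ] (Finset V →₀ ℤ)) (h : ∀ s ∈ S, f (Finsupp.single s 1) ∈ W)
    {z : Finset V →₀ ℤ} (hz : z ∈ Finsupp.supported ℤ ℤ S) : f z ∈ W := by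
  rw [Finsupp.supported_eq_span_single] at hz
  refine (Submodule.span_le (p := W.comap f)).2 ?_ hz
  rintro _ ⟨s, hs, rfl⟩
  exact h s hs

/-- The chains of `K` spanned by the simplices with `n` vertices. -/
def faces (K : Set (Finset V)) (n : ℕ) : Submodule ℤ (Finset V →₀ ℤ) :=
  Finsupp.supported ℤ ℤ {s | s ∈ K ∧ s.card = n}

theorem faces_mono {K K' : Set (Finset V)} (h : K ⊆ K') (n : ℕ) : faces K n ≤ faces K' n :=
  Finsupp.supported_mono fun _ hs => ⟨h hs.1, hs.2⟩

variable [DecidableEq V]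

/-- The simplicial boundary on the free abelian group on all finite sets of vertices. -/
noncomputable def bd : (Finset V →₀ ℤ) →ₗ[ℤ] (Finset V →₀ ℤ) :=
  Finsupp.linearCombination ℤ fun s => ∑ x ∈ s, Finsupp.single (s.erase x) (sgn lt x s)

/-- The signed insertion of the vertex `x`. -/
noncomputable def ins (x : V) : (Finset V →₀ ℤ) →ₗ[ℤ] (Finset V →₀ ℤ) :=
  Finsupp.linearCombination ℤ fun s =>
    if x ∈ s then 0 else Finsupp.single (insert x s) (sgn lt x s)

/-- The signed removal of the vertex `x`. -/
noncomputable def del (x : V) : (Finset V →₀ ℤ) →ₗ[ℤ] (Finset V →₀ ℤ) :=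
  Finsupp.linearCombination ℤ fun s =>
    if x ∈ s then Finsupp.single (s.erase x) (sgn lt x (s.erase x)) else 0

variable {lt}

theorem sgn_insert_of_lt {x y : V} {s : Finset V} (hx : x ∉ s) (h : lt x y) :
    sgn lt y (insert x s) = - sgn lt y s := by
  have : x ∉ s.filter (lt · y) := fun h' => hx (Finset.mem_filter.1 h').1
  rw [sgn, Finset.filter_insert, if_pos h, Finset.card_insert_of_notMem this, sgn, pow_succ]
  ring

theorem sgn_insert_of_not_lt {x y : V} {s : Finset V} (h : ¬ lt x y) :
    sgn lt y (insert x s) = sgn lt y s := by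
  rw [sgn, Finset.filter_insert, if_neg h, sgn]

theorem bd_single (s : Finset V) :
    bd lt (Finsupp.single s 1) = ∑ x ∈ s, Finsupp.single (s.erase x) (sgn lt x s) := by
  simp [bd]

theorem ins_single (x : V) (s : Finset V) (a : ℤ) :
    ins lt x (Finsupp.single s a) =
      if x ∈ s then 0 else Finsupp.single (insert x s) (a * sgn lt x s) := by
  simp only [ins, Finsupp.linearCombination_single]
  split_ifs <;> simp

theorem del_single (x : V) (s : Finset V) (a : ℤ) :
    del lt x (Finsupp.single s a) =
      if x ∈ s then Finsupp.single (s.erase x) (a * sgn lt x (s.erase x)) else 0 := by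
  simp only [del, Finsupp.linearCombination_single]
  split_ifs <;> simp

theorem sgn_insert_mul_sgn [IsStrictTotalOrder V lt] {x y : V} {t : Finset V} (hxy : x ≠ y)
    (hx : x ∉ t) (hy : y ∉ t) :
    sgn lt x (insert y t) * sgn lt y (insert x t) = - (sgn lt y t * sgn lt x t) := by
  by_cases h : lt x y
  · rw [sgn_insert_of_lt hx h, sgn_insert_of_not_lt (asymm_of lt h)]; ring
  · rw [sgn_insert_of_not_lt h, sgn_insert_of_lt hy
      (((trichotomous_of lt x y).resolve_left h).resolve_left hxy)]
    ring

/-- Insertion of a vertex is a contracting homotopy. -/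
theorem bd_ins_add_ins_bd [IsStrictTotalOrder V lt] (x : V) (z : Finset V →₀ ℤ) :
    bd lt (ins lt x z) + ins lt x (bd lt z) = z := by
  suffices h : (bd lt).comp (ins lt x) + (ins lt x).comp (bd lt) = LinearMap.id from
    LinearMap.congr_fun h z
  refine Finsupp.lhom_ext' fun s => LinearMap.ext_ring ?_
  simp only [LinearMap.comp_apply, LinearMap.add_apply, Finsupp.lsingle_apply, LinearMap.id_apply,
    bd_single, map_sum, ins_single]
  by_cases hx : x ∈ s
  · rw [if_pos hx, map_zero, zero_add, Finset.sum_eq_single x]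
    · have h : sgn lt x s = sgn lt x (s.erase x) := by
        conv_lhs => rw [← Finset.insert_erase hx]
        exact sgn_insert_of_not_lt (irrefl_of lt x)
      simp [Finset.insert_erase hx, ← h, sgn_mul_self]
    · intro y _ hyx
      simp [Finset.mem_erase, hx, hyx.symm]
    · exact fun h => absurd hx h
  · have h1 : Finsupp.single (insert x s) (1 * sgn lt x s) =
        sgn lt x s • Finsupp.single (insert x s) (1 : ℤ) := by simp
    rw [if_neg hx, h1, map_smul, bd_single, Finset.sum_insert hx, Finset.erase_insert hx,
      smul_add, Finset.smul_sum, add_assoc, ← Finset.sum_add_distrib, Finset.sum_eq_zero]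
    · simp [sgn_insert_of_not_lt (irrefl_of lt x), sgn_mul_self]
    · intro y hy
      have hxy : x ≠ y := fun h => hx (h ▸ hy)
      have hxe : x ∉ s.erase y := fun h => hx (Finset.mem_of_mem_erase h)
      have key := sgn_insert_mul_sgn (lt := lt) hxy hxe (Finset.notMem_erase y s)
      rw [Finset.insert_erase hy] at key
      have hyi : sgn lt y s = sgn lt y (s.erase y) := by
        conv_lhs => rw [← Finset.insert_erase hy]
        exact sgn_insert_of_not_lt (irrefl_of lt y)
      have hyx : sgn lt y (insert x s) = sgn lt y (insert x (s.erase y)) := by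
        conv_lhs => rw [← Finset.insert_erase hy, Finset.insert_comm]
        exact sgn_insert_of_not_lt (irrefl_of lt y)
      rw [if_neg hxe, Finset.erase_insert_of_ne hxy, Finsupp.smul_single, smul_eq_mul,
        ← Finsupp.single_add, hyx, key, ← hyi]
      simp

theorem bd_mem_supported {S S' : Set (Finset V)} (h : ∀ s ∈ S, ∀ x ∈ s, s.erase x ∈ S')
    {z : Finset V →₀ ℤ} (hz : z ∈ Finsupp.supported ℤ ℤ S) :
    bd lt z ∈ Finsupp.supported ℤ ℤ S' := by
  refine map_mem_of_mem_supported _ (fun s hs => ?_) hz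
  rw [bd_single]
  exact Submodule.sum_mem _ fun x hx => Finsupp.single_mem_supported _ _ (h s hs x hx)

theorem ins_mem_supported {S S' : Set (Finset V)} {x : V}
    (h : ∀ s ∈ S, x ∉ s → insert x s ∈ S')
    {z : Finset V →₀ ℤ} (hz : z ∈ Finsupp.supported ℤ ℤ S) :
    ins lt x z ∈ Finsupp.supported ℤ ℤ S' := by
  refine map_mem_of_mem_supported _ (fun s hs => ?_) hz
  rw [ins_single]
  split_ifs with hx
  · exact Submodule.zero_mem _
  · exact Finsupp.single_mem_supported _ _ (h s hs hx)

theorem del_mem_supported {S S' : Set (Finset V)} {x : V}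
    (h : ∀ s ∈ S, x ∈ s → s.erase x ∈ S')
    {z : Finset V →₀ ℤ} (hz : z ∈ Finsupp.supported ℤ ℤ S) :
    del lt x z ∈ Finsupp.supported ℤ ℤ S' := by
  refine map_mem_of_mem_supported _ (fun s hs => ?_) hz
  rw [del_single]
  split_ifs with hx
  · exact Finsupp.single_mem_supported _ _ (h s hs hx)
  · exact Submodule.zero_mem _

theorem del_eq_zero {x : V} {z : Finset V →₀ ℤ}
    (hz : z ∈ Finsupp.supported ℤ ℤ {s : Finset V | x ∉ s}) : del lt x z = 0 := by
  rw [← Submodule.mem_bot ℤ]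
  refine map_mem_of_mem_supported _ (fun s hs => ?_) hz
  rw [del_single, if_neg hs]
  exact Submodule.zero_mem _

theorem del_ins {x : V} {z : Finset V →₀ ℤ}
    (hz : z ∈ Finsupp.supported ℤ ℤ {s : Finset V | x ∉ s}) : del lt x (ins lt x z) = z := by
  rw [← sub_eq_zero, ← Submodule.mem_bot ℤ]
  refine map_mem_of_mem_supported ((del lt x).comp (ins lt x) - LinearMap.id) (fun s hs => ?_) hz
  have hs' : x ∉ s := hs
  simp [ins_single, hs', del_single, sgn_mul_self]

theorem sub_ins_del_mem_supported {S S' : Set (Finset V)} {x : V}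
    (h : ∀ s ∈ S, x ∉ s → s ∈ S')
    {z : Finset V →₀ ℤ} (hz : z ∈ Finsupp.supported ℤ ℤ S) :
    z - ins lt x (del lt x z) ∈ Finsupp.supported ℤ ℤ S' := by
  refine map_mem_of_mem_supported (LinearMap.id - (ins lt x).comp (del lt x)) (fun s hs => ?_) hz
  by_cases hx : x ∈ s
  · simp [del_single, hx, ins_single, sgn_mul_self, Finset.insert_erase]
  · simp only [LinearMap.sub_apply, LinearMap.id_apply, LinearMap.comp_apply, del_single, hx,
      if_false, map_zero, sub_zero]
    exact Finsupp.single_mem_supported _ _ (h s hs hx)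

variable (lt) in
/-- The reduced homology of `K` vanishes on simplices with fewer than `N` vertices. -/
def AcyclicBelow (K : Set (Finset V)) (N : ℕ) : Prop :=
  ∀ n < N, ∀ z ∈ faces K n, bd lt z = 0 → ∃ w ∈ faces K (n + 1), bd lt w = z

theorem AcyclicBelow.mono {K : Set (Finset V)} {N N' : ℕ} (h : AcyclicBelow lt K N)
    (hN : N' ≤ N) : AcyclicBelow lt K N' :=
  fun n hn => h n (hn.trans_le hN)

/-- Cones are acyclic. -/
theorem acyclicBelow_cone [IsStrictTotalOrder V lt] {K : Set (Finset V)} (x : V)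
    (h : ∀ s ∈ K, insert x s ∈ K) (N : ℕ) : AcyclicBelow lt K N := by
  intro n _ z hz hbd
  refine ⟨ins lt x z, ins_mem_supported (fun s hs hx => ?_) hz, ?_⟩
  · exact ⟨h s hs.1, by rw [Finset.card_insert_of_notMem hx, hs.2]⟩
  · simpa [hbd] using bd_ins_add_ins_bd (lt := lt) x z

/-- If the deletion and the link of a vertex are acyclic in a range, so is the complex. -/
theorem acyclicBelow_of_vertex [IsStrictTotalOrder V lt] {K : Set (Finset V)}
    (x : V) {N : ℕ}
    (hdel : AcyclicBelow lt {s | s ∈ K ∧ x ∉ s} N)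
    (hlink : AcyclicBelow lt {s | insert x s ∈ K ∧ x ∉ s} (N - 1))
    (hK : ∀ s, insert x s ∈ K → s ∈ K) :
    AcyclicBelow lt K N := by
  intro n hn z hz hbd
  set u := del lt x z with hu
  set v := z - ins lt x u with hv
  have hux : u ∈ Finsupp.supported ℤ ℤ {s : Finset V | x ∉ s} :=
    del_mem_supported (fun s _ _ => Finset.notMem_erase x s) hz
  have hvK : v ∈ faces {s | s ∈ K ∧ x ∉ s} n :=
    sub_ins_del_mem_supported (S' := {s | (s ∈ K ∧ x ∉ s) ∧ s.card = n})
      (fun s hs hx => ⟨⟨hs.1, hx⟩, hs.2⟩) hz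
  have hvx : v ∈ Finsupp.supported ℤ ℤ {s : Finset V | x ∉ s} :=
    Finsupp.supported_mono (fun s hs => hs.1.2) hvK
  have herase : ∀ s ∈ {s : Finset V | x ∉ s}, ∀ y ∈ s, s.erase y ∈ {s : Finset V | x ∉ s} :=
    fun s hs y _ h => hs (Finset.mem_of_mem_erase h)
  have hbu := bd_ins_add_ins_bd (lt := lt) x u
  have hz' : z = ins lt x u + v := by rw [hv]; abel
  have h0 : u - ins lt x (bd lt u) + bd lt v = 0 := by
    rw [← hbd, hz', map_add, sub_eq_iff_eq_add.2 hbu.symm]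
  have hu0 : bd lt u = 0 := by
    have := congrArg (del lt x) h0
    rw [map_add, map_sub, del_eq_zero hux, del_ins (bd_mem_supported herase hux),
      del_eq_zero (bd_mem_supported herase hvx), map_zero] at this
    simpa using this
  have huv : u + bd lt v = 0 := by simpa [hu0] using h0
  obtain ⟨w, hw, hwu⟩ : ∃ w ∈ faces {s | insert x s ∈ K ∧ x ∉ s} n, bd lt w = u := by
    cases n with
    | zero =>
      refine ⟨0, Submodule.zero_mem _, ?_⟩
      rw [map_zero, hu, del_eq_zero]
      refine Finsupp.supported_mono (fun s hs => ?_) hz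
      simp [Finset.card_eq_zero.1 hs.2]
    | succ k =>
      refine hlink k (by omega) u (del_mem_supported (fun s hs hx => ?_) hz) hu0
      exact ⟨⟨by simpa [Finset.insert_erase hx] using hs.1, Finset.notMem_erase x s⟩,
        by rw [Finset.card_erase_of_mem hx, hs.2]; rfl⟩
  have hwx := bd_ins_add_ins_bd (lt := lt) x w
  obtain ⟨y, hy, hyv⟩ := hdel n hn (v + w)
    (Submodule.add_mem _ hvK (faces_mono (K' := {s | s ∈ K ∧ x ∉ s})
      (fun s hs => ⟨hK s hs.1, hs.2⟩) n hw))
    (by rw [map_add, hwu, add_comm, huv])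
  refine ⟨y - ins lt x w, Submodule.sub_mem _ ?_
    (ins_mem_supported (S' := {s | s ∈ K ∧ s.card = n + 1}) (fun s hs hx => ?_) hw), ?_⟩
  · exact faces_mono (fun s hs => hs.1) _ hy
  · exact ⟨hs.1.1, by rw [Finset.card_insert_of_notMem hx, hs.2]⟩
  · rw [map_sub, hyv, hz', eq_sub_of_add_eq hwx, hwu]
    abel

end Complexes

/-! ### Order complexes -/

section OrderComplexes

variable {P : Type*} [PartialOrder P]

/-- The complex of all finite chains contained in a set. -/
def orderComplex (A : Set P) : Set (Finset P) := {s | ↑s ⊆ A ∧ IsChain (· ≤ ·) (s : Set P)}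

variable (P) in
/-- A strict total order extending the given partial order. -/
theorem exists_isStrictTotalOrder :
    ∃ lt : P → P → Prop, IsStrictTotalOrder P lt ∧ ∀ x y : P, x < y → lt x y := by
  refine ⟨fun x y => toLinearExtension x < toLinearExtension y, ?_, fun x y h => ?_⟩
  · exact inferInstanceAs (IsStrictTotalOrder (LinearExtension P) (· < ·))
  · exact lt_of_le_of_ne (toLinearExtension.monotone h.le) h.ne

variable {Q : Type*} [PartialOrder Q] (φ : Q ↪o P)

/-- The set of vertices, in `P`, of a chain of `Q`. -/
def vertexSet {n : ℕ} (c : Fin n ↪o Q) : Finset P :=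
  Finset.univ.map (c.trans φ).toEmbedding

theorem vertexSet_injective (n : ℕ) :
    Function.Injective (vertexSet φ : (Fin n ↪o Q) → Finset P) := by
  intro c c' h
  have h' := congrArg (fun s : Finset P => (s : Set P)) h
  simp only [vertexSet, Finset.coe_map, Finset.coe_univ, Set.image_univ] at h'
  have := (OrderEmbedding.range_inj (f := c.trans φ) (g := c'.trans φ)).1 h'
  ext k
  exact φ.injective (DFunLike.congr_fun this k)

theorem card_vertexSet {n : ℕ} (c : Fin n ↪o Q) : (vertexSet φ c).card = n := by
  simp [vertexSet]

theorem vertexSet_mem {n : ℕ} (c : Fin n ↪o Q) : vertexSet φ c ∈ orderComplex (Set.range φ) := by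
  constructor
  · intro x hx
    simp only [vertexSet, Finset.coe_map, Finset.coe_univ, Set.image_univ] at hx
    obtain ⟨k, rfl⟩ := hx
    exact ⟨c k, rfl⟩
  · intro x hx y hy _
    simp only [vertexSet, Finset.coe_map, Finset.coe_univ, Set.image_univ] at hx hy
    obtain ⟨k, rfl⟩ := hx
    obtain ⟨l, rfl⟩ := hy
    rcases le_total k l with h | h
    · exact Or.inl (φ.monotone (c.monotone h))
    · exact Or.inr (φ.monotone (c.monotone h))

theorem exists_vertexSet_eq {s : Finset P} (hs : s ∈ orderComplex (Set.range φ)) {n : ℕ}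
    (hn : s.card = n) : ∃ c : Fin n ↪o Q, vertexSet φ c = s := by
  classical
  let _ : LinearOrder s :=
    { (inferInstance : PartialOrder s) with
      le_total := fun x y => hs.2.total x.2 y.2
      toDecidableLE := Classical.decRel _ }
  let e : Fin n ≃o s := Fintype.orderIsoFinOfCardEq s (by simpa using hn)
  have hsub : ∀ x : s, ∃ q, φ q = x := fun x => hs.1 x.2
  choose g hg using hsub
  refine ⟨OrderEmbedding.ofMapLEIff (fun k => g (e k)) fun k l => ?_, ?_⟩
  · rw [← φ.le_iff_le, hg, hg]
    exact e.le_iff_le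
  · ext x
    simp only [vertexSet, Finset.mem_map, Finset.mem_univ, true_and]
    constructor
    · rintro ⟨k, rfl⟩
      change φ (g (e k)) ∈ s
      rw [hg]
      exact (e k).2
    · intro hx
      refine ⟨e.symm ⟨x, hx⟩, ?_⟩
      change φ (g (e _)) = x
      rw [hg]
      simp

/-- The chains of `Q`, as chains of the order complex in `P`. -/
noncomputable def chainMap (n : ℕ) : Chains Q n →ₗ[ℤ] (Finset P →₀ ℤ) :=
  Finsupp.lmapDomain ℤ ℤ (vertexSet φ)

theorem chainMap_injective (n : ℕ) : Function.Injective (chainMap φ n) :=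
  Finsupp.mapDomain_injective (vertexSet_injective φ n)

theorem range_chainMap (n : ℕ) :
    LinearMap.range (chainMap φ n) = faces (orderComplex (Set.range φ)) n := by
  rw [chainMap, Finsupp.range_lmapDomain, faces, Finsupp.supported_eq_span_single]
  congr 1
  ext z
  constructor
  · rintro ⟨c, rfl⟩
    exact ⟨_, ⟨vertexSet_mem φ c, card_vertexSet φ c⟩, rfl⟩
  · rintro ⟨s, ⟨hs, hn⟩, rfl⟩
    obtain ⟨c, rfl⟩ := exists_vertexSet_eq φ hs hn
    exact ⟨c, rfl⟩

variable (lt : P → P → Prop) [DecidableRel lt] [IsStrictTotalOrder P lt]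

theorem sgn_vertexSet (hlt : ∀ x y : P, x < y → lt x y) {n : ℕ} (c : Fin n ↪o Q) (k : Fin n) :
    sgn lt (φ (c k)) (vertexSet φ c) = (-1) ^ (k : ℕ) := by
  have h : (vertexSet φ c).filter (lt · (φ (c k))) =
      (Finset.Iio k).map (c.trans φ).toEmbedding := by
    ext x
    simp only [vertexSet, Finset.mem_filter, Finset.mem_map, Finset.mem_univ, true_and,
      Finset.mem_Iio]
    constructor
    · rintro ⟨⟨l, rfl⟩, h⟩
      refine ⟨l, lt_of_not_ge fun hkl => ?_, rfl⟩
      rcases hkl.eq_or_lt with rfl | hkl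
      · exact irrefl_of lt _ h
      · exact asymm_of lt h (hlt _ _ (φ.strictMono (c.strictMono hkl)))
    · rintro ⟨l, hl, rfl⟩
      exact ⟨⟨l, rfl⟩, hlt _ _ (φ.strictMono (c.strictMono hl))⟩
  rw [sgn, h, Finset.card_map, Fin.card_Iio]

variable [DecidableEq P]

theorem erase_vertexSet {n : ℕ} (c : Fin (n + 1) ↪o Q) (k : Fin (n + 1)) :
    (vertexSet φ c).erase (φ (c k)) = vertexSet φ ((Fin.succAboveOrderEmb k).trans c) := by
  ext x
  simp only [vertexSet, Finset.mem_erase, Finset.mem_map, Finset.mem_univ, true_and]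
  constructor
  · rintro ⟨hx, l, rfl⟩
    have hlk : l ≠ k := fun h => hx (by rw [h]; rfl)
    obtain ⟨j, rfl⟩ := Fin.exists_succAbove_eq hlk
    exact ⟨j, rfl⟩
  · rintro ⟨j, rfl⟩
    exact ⟨fun h => Fin.succAbove_ne k j (c.injective (φ.injective h)), _, rfl⟩

theorem bd_chainMap (hlt : ∀ x y : P, x < y → lt x y) (n : ℕ) (z : Chains Q (n + 1)) :
    bd lt (chainMap φ (n + 1) z) = chainMap φ n (boundary Q n z) := by
  suffices h : (bd lt).comp (chainMap φ (n + 1)) = (chainMap φ n).comp (boundary Q n) from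
    LinearMap.congr_fun h z
  refine Finsupp.lhom_ext' fun c => LinearMap.ext_ring ?_
  simp only [LinearMap.comp_apply, Finsupp.lsingle_apply, boundary_single, map_sum, chainMap,
    Finsupp.lmapDomain_apply, Finsupp.mapDomain_single, bd_single]
  have h : ∀ f : P → (Finset P →₀ ℤ), ∑ x ∈ vertexSet φ c, f x = ∑ k, f (φ (c k)) := fun f => by
    rw [vertexSet, Finset.sum_map]; rfl
  rw [h]
  refine Finset.sum_congr rfl fun k _ => ?_
  rw [erase_vertexSet, sgn_vertexSet φ lt hlt, one_mul]

/-- Acyclicity of the order complex of the image of `Q` gives vanishing of the reduced homology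
of `Q`. -/
theorem cycles_le_boundaries (hlt : ∀ x y : P, x < y → lt x y) {N : ℕ}
    (h : AcyclicBelow lt (orderComplex (Set.range φ)) N) {n : ℕ} (hn : n < N) :
    cycles Q n ≤ boundaries Q n := by
  intro z hz
  have hbd : bd lt (chainMap φ n z) = 0 := by
    cases n with
    | zero =>
      rw [← Submodule.mem_bot ℤ]
      refine map_mem_of_mem_supported (S := {∅}) _ (fun s hs => ?_) ?_
      · rw [Set.mem_singleton_iff.1 hs, bd_single]
        simp
      · have : chainMap φ 0 z ∈ faces (orderComplex (Set.range φ)) 0 :=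
          range_chainMap φ 0 ▸ ⟨z, rfl⟩
        exact Finsupp.supported_mono (fun s hs => Finset.card_eq_zero.1 hs.2) this
    | succ n =>
      have hz' : boundary Q n z = 0 := hz
      rw [bd_chainMap φ lt hlt, hz', map_zero]
  obtain ⟨w, hw, hwz⟩ := h n hn _ (range_chainMap φ n ▸ ⟨z, rfl⟩) hbd
  rw [← range_chainMap] at hw
  obtain ⟨w, rfl⟩ := hw
  refine ⟨w, chainMap_injective φ n ?_⟩
  rw [← bd_chainMap φ lt hlt, hwz]

end OrderComplexes

section OrderComplexes

variable {P : Type*} [PartialOrder P] [DecidableEq P]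
  {lt : P → P → Prop} [DecidableRel lt] [IsStrictTotalOrder P lt]

/-- The order complex is a cone if some element is comparable to all the others. -/
theorem acyclicBelow_orderComplex_cone {A : Set P} {c : P} (hc : c ∈ A)
    (h : ∀ a ∈ A, a ≤ c ∨ c ≤ a) (N : ℕ) : AcyclicBelow lt (orderComplex A) N := by
  refine acyclicBelow_cone c (fun s hs => ?_) N
  refine ⟨?_, ?_⟩
  · rw [Finset.coe_insert]
    exact Set.insert_subset hc hs.1
  · rw [Finset.coe_insert]
    exact hs.2.insert fun b hb _ => (h b (hs.1 hb)).symm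

/-- Adjoining one element to a partial order. -/
theorem acyclicBelow_orderComplex_insert {A : Set P} {x : P} (hx : x ∉ A) {N : ℕ}
    (h : AcyclicBelow lt (orderComplex A) N)
    (hl : AcyclicBelow lt (orderComplex {y | y ∈ A ∧ (y < x ∨ x < y)}) (N - 1)) :
    AcyclicBelow lt (orderComplex (insert x A)) N := by
  refine acyclicBelow_of_vertex x ?_ ?_ fun s hs => ?_
  · convert h using 1
    ext s
    simp only [orderComplex, Set.mem_ofPred_eq]
    constructor
    · rintro ⟨⟨h1, h2⟩, h3⟩
      exact ⟨(Set.subset_insert_iff_of_notMem (by simpa using h3)).1 h1, h2⟩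
    · rintro ⟨h1, h2⟩
      exact ⟨⟨h1.trans (Set.subset_insert x A), h2⟩, fun h => hx (h1 h)⟩
  · convert hl using 1
    ext s
    simp only [orderComplex, Set.mem_ofPred_eq, Finset.coe_insert]
    constructor
    · rintro ⟨⟨h1, h2⟩, h3⟩
      refine ⟨fun y hy => ?_, h2.mono (Set.subset_insert _ _)⟩
      have hyx : y ≠ x := fun e => h3 (e ▸ hy)
      refine ⟨(h1 (Set.mem_insert_of_mem _ hy)).resolve_left hyx, ?_⟩
      rcases h2 (Set.mem_insert_of_mem _ hy) (Set.mem_insert _ _) hyx with h' | h'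
      · exact Or.inl (lt_of_le_of_ne h' hyx)
      · exact Or.inr (lt_of_le_of_ne h' hyx.symm)
    · rintro ⟨h1, h2⟩
      refine ⟨⟨Set.insert_subset_insert fun y hy => (h1 hy).1, h2.insert fun y hy _ => ?_⟩,
        fun h' => hx (h1 h').1⟩
      exact (h1 hy).2.symm.imp le_of_lt le_of_lt
  · rw [orderComplex, Set.mem_ofPred_eq, Finset.coe_insert] at hs
    exact ⟨(Set.subset_insert x _).trans hs.1, hs.2.mono (Set.subset_insert x _)⟩

end OrderComplexes

/-! ### Sets of large rank in a matroid -/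

section LargeRank

variable {α : Type*} (M : Matroid α)

theorem rk_cast (S : Finset α) : (rk M (S : Set α) : ℕ∞) = M.eRk S :=
  ENat.natCast_toNat ((M.eRk_le_encard S).trans_lt (by simp)).ne

theorem rk_mono {S T : Finset α} (h : S ⊆ T) : rk M (S : Set α) ≤ rk M (T : Set α) := by
  rw [← Nat.cast_le (α := ℕ∞), rk_cast, rk_cast]
  exact M.eRk_mono (by exact_mod_cast h)

theorem rk_le_card (S : Finset α) : rk M (S : Set α) ≤ S.card := by
  rw [← Nat.cast_le (α := ℕ∞), rk_cast, ← Set.encard_coe_eq_coe_finsetCard]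
  exact M.eRk_le_encard _

theorem rk_eq_card_of_indep {S : Finset α} (h : M.Indep S) : rk M (S : Set α) = S.card := by
  rw [← Nat.cast_inj (R := ℕ∞), rk_cast, ← Set.encard_coe_eq_coe_finsetCard, h.eRk_eq_encard]

variable [DecidableEq α]

theorem exists_indep_insert {A T : Finset α} (hA : M.Indep A)
    (h : A.card < rk M (T : Set α)) : ∃ e ∈ T, e ∉ A ∧ M.Indep (insert e A : Finset α) := by
  obtain ⟨I, hI⟩ := M.exists_isBasis' T
  obtain ⟨e, he, hi⟩ := hA.augment hI.indep (by
    rw [hI.encard_eq_eRk, ← rk_cast, Set.encard_coe_eq_coe_finsetCard]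
    exact_mod_cast h)
  exact ⟨e, by exact_mod_cast hI.subset he.1, by exact_mod_cast he.2, by simpa using hi⟩

/-- The proper subsets of `T` of rank at least `r` which contain `A`. -/
def largeBetween (A T : Finset α) (r : ℕ) : Set (Finset α) :=
  {S | A ⊆ S ∧ S ⊂ T ∧ r ≤ rk M (S : Set α)}

variable {lt : Finset α → Finset α → Prop} [DecidableRel lt] [IsStrictTotalOrder (Finset α) lt]

/-- Adjoining sets which avoid `e`, other than `T \ {e}`, preserves acyclicity: in the order of
increasing cardinality, the link of each such `S` is a cone with apex `S ∪ {e}`. -/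
theorem acyclicBelow_largeBetween_union {A T : Finset α} {r N : ℕ} {e : α} (heT : e ∈ T)
    (h : AcyclicBelow lt (orderComplex (largeBetween M (insert e A) T r)) N)
    (D : Finset (Finset α))
    (hD : ∀ S ∈ D, S ∈ largeBetween M A T r ∧ e ∉ S ∧ S ≠ T.erase e) :
    AcyclicBelow lt (orderComplex (largeBetween M (insert e A) T r ∪ (D : Set (Finset α)))) N := by
  revert hD
  refine Finset.induction_on_max_value (motive := fun D => (∀ S ∈ D, S ∈ largeBetween M A T r ∧
    e ∉ S ∧ S ≠ T.erase e) → AcyclicBelow lt (orderComplex (largeBetween M (insert e A) T r ∪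
      (D : Set (Finset α)))) N) Finset.card D ?_ ?_
  · intro _
    simpa using h
  · intro S D hSD hmax ih hD
    have ih := ih fun S' hS' => hD S' (Finset.mem_insert_of_mem hS')
    obtain ⟨⟨hAS, hST, hr⟩, heS, hne⟩ := hD S (Finset.mem_insert_self S D)
    rw [Finset.coe_insert, Set.union_insert]
    refine acyclicBelow_orderComplex_insert ?_ ih ?_
    · rintro (h' | h')
      · exact heS (h'.1 (Finset.mem_insert_self e A))
      · exact hSD h'
    · refine acyclicBelow_orderComplex_cone (c := insert e S) ?_ ?_ _
      · refine ⟨Or.inl ⟨Finset.insert_subset_insert e hAS, ?_, ?_⟩, ?_⟩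
        · refine lt_of_le_of_ne (Finset.insert_subset heT hST.1) fun h' => hne ?_
          rw [← h', Finset.erase_insert heS]
        · exact hr.trans (rk_mono M (Finset.subset_insert e S))
        · exact Or.inr (Finset.ssubset_insert heS)
      · rintro S' ⟨hS', h' | h'⟩
        · exact Or.inl (h'.le.trans (Finset.subset_insert e S))
        · rcases hS' with hS' | hS'
          · exact Or.inr (Finset.insert_subset (hS'.1 (Finset.mem_insert_self e A)) h'.le)
          · exact absurd (Finset.card_lt_card h') (hmax S' hS').not_gt

/-- The sets of rank at least `r` between an independent set `A` and `T` have no homology below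
the top degree. -/
theorem acyclicBelow_largeBetween (k : ℕ) : ∀ {A T : Finset α} {r : ℕ}, T.card - A.card = k →
    M.Indep A → A ⊆ T → A.card ≤ r → r ≤ rk M (T : Set α) →
    AcyclicBelow lt (orderComplex (largeBetween M A T r)) (T.card - r) := by
  induction k using Nat.strong_induction_on with
  | _ k ih =>
  intro A T r hk hA hAT hAr hrT
  rcases hAr.eq_or_lt with rfl | hAr
  · rcases hAT.eq_or_ssubset with rfl | hss
    · intro n hn
      omega
    · refine acyclicBelow_orderComplex_cone (c := A) ?_ (fun S hS => Or.inr hS.1) _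
      exact ⟨subset_rfl, hss, (rk_eq_card_of_indep M hA).ge⟩
  obtain ⟨e, heT, heA, hi⟩ := exists_indep_insert M hA (hAr.trans_le hrT)
  have hcard : (insert e A).card = A.card + 1 := Finset.card_insert_of_notMem heA
  have hins : insert e A ⊆ T := Finset.insert_subset heT hAT
  have hle := Finset.card_le_card hins
  have h1 := ih _ (by omega) (A := insert e A) (T := T) (r := r) rfl hi hins (by omega) hrT
  classical
  have h2 := acyclicBelow_largeBetween_union M heT h1
    (T.powerset.filter fun S => S ∈ largeBetween M A T r ∧ e ∉ S ∧ S ≠ T.erase e)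
    fun S hS => (Finset.mem_filter.1 hS).2
  set B : Set (Finset α) := largeBetween M (insert e A) T r ∪
    ((T.powerset.filter fun S => S ∈ largeBetween M A T r ∧ e ∉ S ∧ S ≠ T.erase e :
      Finset (Finset α)) : Set (Finset α)) with hB
  have hmemB : ∀ S, S ∈ B ↔ S ∈ largeBetween M A T r ∧ S ≠ T.erase e := by
    intro S
    simp only [hB, Set.mem_union, Finset.coe_filter, Finset.mem_powerset, Set.mem_ofPred_eq]
    constructor
    · rintro (h | h)
      · exact ⟨⟨(Finset.subset_insert e A).trans h.1, h.2⟩, fun h' =>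
          Finset.notMem_erase e T (h' ▸ h.1 (Finset.mem_insert_self e A))⟩
      · exact ⟨h.2.1, h.2.2.2⟩
    · rintro ⟨h, hne⟩
      by_cases heS : e ∈ S
      · exact Or.inl ⟨Finset.insert_subset heS h.1, h.2⟩
      · exact Or.inr ⟨h.2.1.1, h, heS, hne⟩
  by_cases hTe : r ≤ rk M (T.erase e : Finset α)
  · have hTL : T.erase e ∈ largeBetween M A T r :=
      ⟨Finset.subset_erase.2 ⟨hAT, heA⟩, Finset.erase_ssubset heT, hTe⟩
    have hTcard : (T.erase e).card = T.card - 1 := Finset.card_erase_of_mem heT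
    have h3 := ih _ (by omega) (A := A) (T := T.erase e) (r := r) rfl hA hTL.1 hAr.le hTe
    have heq : largeBetween M A T r = insert (T.erase e) B := by
      ext S
      rw [Set.mem_insert_iff, hmemB]
      by_cases hS : S = T.erase e
      · simp [hS, hTL]
      · simp [hS]
    rw [heq]
    refine acyclicBelow_orderComplex_insert (fun h => ((hmemB _).1 h).2 rfl) h2 ?_
    have hlink : {S | S ∈ B ∧ (S < T.erase e ∨ T.erase e < S)} =
        largeBetween M A (T.erase e) r := by
      ext S
      rw [Set.mem_ofPred_eq, hmemB]
      constructor
      · rintro ⟨⟨h, -⟩, h' | h'⟩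
        · exact ⟨h.1, h', h.2.2⟩
        · refine absurd (Finset.card_lt_card h') ?_
          have := Finset.card_lt_card h.2.1
          omega
      · rintro ⟨h, h', h''⟩
        exact ⟨⟨⟨h, h'.trans (Finset.erase_ssubset heT), h''⟩, h'.ne⟩, Or.inl h'⟩
    rw [hlink]
    exact h3.mono (by omega)
  · have heq : largeBetween M A T r = B := by
      ext S
      rw [hmemB]
      exact ⟨fun h => ⟨h, fun h' => hTe (h' ▸ h.2.2)⟩, And.left⟩
    rwa [heq]

end LargeRank

/-! ### Ranks of homology groups and the Möbius function -/

section Ranks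

variable (Q : Type*) [PartialOrder Q]

theorem subsingleton_reducedHomology {n : ℕ} (h : cycles Q n ≤ boundaries Q n) :
    Subsingleton (ReducedHomology Q n) :=
  Submodule.Quotient.subsingleton_iff.2 (Submodule.submoduleOf_eq_top.2 h)

variable [Finite Q]

instance (n : ℕ) : Finite (Fin n ↪o Q) := DFunLike.finite _

instance (n : ℕ) : Module.Finite ℤ (cycles Q n) :=
  Module.IsNoetherian.finite ℤ _

instance (n : ℕ) : Module.Free ℤ (cycles Q n) :=
  Module.free_of_finite_type_torsion_free'

theorem finrank_chains (n : ℕ) : Module.finrank ℤ (Chains Q n) = Nat.card (Fin n ↪o Q) := by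
  have _ := Fintype.ofFinite (Fin n ↪o Q)
  rw [Module.finrank_finsupp_self, Nat.card_eq_fintype_card]

theorem finrank_cycles_succ {n : ℕ} (h : cycles Q n ≤ boundaries Q n) :
    (Module.finrank ℤ (cycles Q (n + 1)) : ℤ) =
      Nat.card (Fin (n + 1) ↪o Q) - Module.finrank ℤ (cycles Q n) := by
  have h1 := Submodule.finrank_quotient_add_finrank (LinearMap.ker (boundary Q n))
  rw [(boundary Q n).quotKerEquivRange.finrank_eq, finrank_chains] at h1
  have h2 : cycles Q n = LinearMap.range (boundary Q n) :=
    le_antisymm h (boundaries_le_cycles Q n)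
  rw [← h1, h2]
  simp only [Nat.cast_add, add_sub_cancel_left]
  rfl

theorem finrank_cycles {N : ℕ} (h : ∀ n < N, cycles Q n ≤ boundaries Q n) :
    (Module.finrank ℤ (cycles Q N) : ℤ) =
      (-1) ^ N * ∑ n ∈ Finset.range (N + 1), (-1) ^ n * (Nat.card (Fin n ↪o Q) : ℤ) := by
  induction N with
  | zero =>
    have : Module.finrank ℤ (cycles Q 0) = Module.finrank ℤ (Chains Q 0) := finrank_top ℤ _
    simp [this, finrank_chains]
  | succ N ih =>
    rw [finrank_cycles_succ Q (h N N.lt_succ_self), ih fun n hn => h n (hn.trans N.lt_succ_self),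
      Finset.sum_range_succ _ (N + 1), mul_add, ← mul_assoc ((-1 : ℤ) ^ (N + 1)), ← mul_pow]
    simp only [pow_succ]
    ring_nf

/-- In the top degree the homology consists of the cycles. -/
noncomputable def reducedHomologyEquivCycles (N : ℕ) [IsEmpty (Fin (N + 1) ↪o Q)] :
    ReducedHomology Q N ≃ₗ[ℤ] cycles Q N := by
  refine Submodule.quotEquivOfEqBot _ ?_
  have : boundaries Q N = ⊥ := by
    rw [boundaries, LinearMap.range_eq_bot]
    exact Finsupp.lhom_ext fun c => isEmptyElim c
  rw [this, Submodule.submoduleOf, Submodule.comap_bot, Submodule.ker_subtype]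

end Ranks

section Hall

variable (P : Type*) [PartialOrder P] [OrderBot P] 

open Classical in
theorem sum_mobius_bot [inst : Fintype P] (a : P) :
    ∑ x : P with x ≤ a, mobius P ⊥ x = if a = ⊥ then 1 else 0 := by
  have hF : Finite P := inferInstance
  obtain rfl : inst = @Fintype.ofFinite P hF := Subsingleton.elim _ _
  let _ : Fintype P := Fintype.ofFinite P
  let _ : LocallyFiniteOrder P := Fintype.toLocallyFiniteOrder
  have h := IncidenceAlgebra.sum_Icc_mu_right (𝕜 := ℤ) (⊥ : P) a
  simp only [eq_comm (a := a), ← h, mobius]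
  refine Finset.sum_congr ?_ fun _ _ => rfl
  ext x
  simp

variable {P}

theorem sigma_chain_ext {n : ℕ} {a : P} {x x' : Set.Ioo ⊥ a} (h : x = x')
    {c : Fin n ↪o Set.Ioo ⊥ (x : P)} {c' : Fin n ↪o Set.Ioo ⊥ (x' : P)}
    (hc : ∀ k, (c k : P) = c' k) :
    (⟨x, c⟩ : Σ x : Set.Ioo ⊥ a, (Fin n ↪o Set.Ioo ⊥ (x : P))) = ⟨x', c'⟩ := by
  subst h
  congr
  ext k
  exact hc k

/-- A chain with `n + 1` elements below `a` is a chain with `n` elements below its maximum. -/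
def chainEquiv (n : ℕ) (a : P) :
    (Fin (n + 1) ↪o Set.Ioo ⊥ a) ≃ Σ x : Set.Ioo ⊥ a, (Fin n ↪o Set.Ioo ⊥ (x : P)) where
  toFun c := ⟨c (Fin.last n), OrderEmbedding.ofMapLEIff
    (fun k => ⟨c k.castSucc, (c k.castSucc).2.1, c.strictMono k.castSucc_lt_last⟩)
    fun k l => by
      change c k.castSucc ≤ c l.castSucc ↔ _
      simp⟩
  invFun y := OrderEmbedding.ofStrictMono
    (Fin.snoc (α := fun _ => Set.Ioo ⊥ a)
      (fun k => ⟨y.2 k, (y.2 k).2.1, (y.2 k).2.2.trans y.1.2.2⟩) y.1)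
    (by
      intro k l
      refine Fin.lastCases (fun h => absurd h (Fin.le_last _).not_gt) (fun k => ?_) k
      refine Fin.lastCases (fun _ => ?_) (fun l h => ?_) l
      · rw [Fin.snoc_castSucc, Fin.snoc_last]
        exact (y.2 k).2.2
      · rw [Fin.snoc_castSucc, Fin.snoc_castSucc]
        exact y.2.strictMono (Fin.castSucc_lt_castSucc_iff.1 h))
  left_inv c := by
    ext k
    refine Fin.lastCases ?_ (fun k => ?_) k <;> simp
  right_inv y := by
    obtain ⟨x, c⟩ := y
    refine sigma_chain_ext ?_ fun k => ?_
    · change Fin.snoc (α := fun _ => Set.Ioo ⊥ a)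
        (fun k => ⟨c k, (c k).2.1, (c k).2.2.trans x.2.2⟩) x (Fin.last n) = x
      exact Fin.snoc_last _ _
    · exact congrArg Subtype.val (Fin.snoc_castSucc (α := fun _ => Set.Ioo ⊥ a) _ _ k)

theorem card_chains_succ [Fintype P] [DecidableLT P] (n : ℕ) (a : P) :
    Nat.card (Fin (n + 1) ↪o Set.Ioo ⊥ a) =
      ∑ x : P with ⊥ < x ∧ x < a, Nat.card (Fin n ↪o Set.Ioo ⊥ x) := by
  rw [Nat.card_congr (chainEquiv n a), Nat.card_sigma]
  exact (Finset.sum_subtype (p := (· ∈ Set.Ioo ⊥ a)) _ (by simp)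
    fun x => Nat.card (Fin n ↪o Set.Ioo ⊥ x)).symm

open Classical in
theorem sum_card_chains [Fintype P] (N : ℕ) : ∀ a : P, ⊥ < a → IsEmpty (Fin N ↪o Set.Ioo ⊥ a) →
    ∑ n ∈ Finset.range N, (-1) ^ n * (Nat.card (Fin n ↪o Set.Ioo ⊥ a) : ℤ) = - mobius P ⊥ a := by
  induction N with
  | zero =>
    intro a _ h
    exact (h.false (OrderEmbedding.ofIsEmpty)).elim
  | succ N ih =>
    intro a ha h
    have hμ := sum_mobius_bot P a
    rw [if_neg ha.ne'] at hμ
    have hsplit : (Finset.univ.filter fun x : P => x ≤ a) =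
        insert a (insert ⊥ (Finset.univ.filter fun x : P => ⊥ < x ∧ x < a)) := by
      ext x
      simp only [Finset.mem_filter, Finset.mem_univ, true_and, Finset.mem_insert]
      rcases eq_or_ne x ⊥ with rfl | hx
      · simp
      · simp [hx, bot_lt_iff_ne_bot, le_iff_eq_or_lt]
    have hbot : mobius P ⊥ ⊥ = 1 := by
      have := sum_mobius_bot P ⊥
      rw [if_pos rfl] at this
      rwa [Finset.sum_eq_single ⊥ (by simp +contextual) (by simp)] at this
    rw [hsplit, Finset.sum_insert (by simp [ha.ne']), Finset.sum_insert (by simp), hbot] at hμ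
    rw [Finset.sum_range_succ']
    have hx : ∀ x : P, ⊥ < x ∧ x < a → ∑ n ∈ Finset.range N,
        (-1) ^ n * (Nat.card (Fin n ↪o Set.Ioo ⊥ x) : ℤ) = - mobius P ⊥ x := fun x hx =>
      ih x hx.1 ⟨fun c => h.false ((chainEquiv N a).symm ⟨⟨x, hx⟩, c⟩)⟩
    have hsum : ∑ n ∈ Finset.range N,
        (-1) ^ (n + 1) * (Nat.card (Fin (n + 1) ↪o Set.Ioo ⊥ a) : ℤ) =
        ∑ x : P with ⊥ < x ∧ x < a, mobius P ⊥ x := by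
      simp only [card_chains_succ, Nat.cast_sum, Finset.mul_sum]
      rw [Finset.sum_comm]
      refine Finset.sum_congr rfl fun x hx' => ?_
      rw [← neg_eq_iff_eq_neg.2 (hx x (Finset.mem_filter.1 hx').2), ← Finset.sum_neg_distrib]
      refine Finset.sum_congr rfl fun n _ => by ring
    have h0 : Nat.card (Fin 0 ↪o Set.Ioo ⊥ a) = 1 :=
      Nat.card_eq_one_iff_unique.2 ⟨⟨fun c c' => by ext k; exact k.elim0⟩,
        ⟨OrderEmbedding.ofIsEmpty⟩⟩
    rw [hsum, h0]
    simp only [pow_zero, Nat.cast_one, mul_one]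
    linarith

end Hall

/-! ### Möbius inversion on sets of large rank -/

section Inversion

variable {α : Type*} [DecidableEq α]

theorem sum_between {β : Type*} [AddCommMonoid β] {R T : Finset α} (h : R ⊆ T) (f : ℕ → β) :
    ∑ S ∈ T.powerset with R ⊆ S, f S.card = ∑ U ∈ (T \ R).powerset, f (R.card + U.card) := by
  have h1 : T.powerset.filter (R ⊆ ·) = (T \ R).powerset.image (R ∪ ·) := by
    rw [← Finset.Icc_eq_image_powerset h]
    ext S
    simp [and_comm]
  rw [h1, Finset.sum_image]
  · refine Finset.sum_congr rfl fun U hU => ?_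
    rw [Finset.card_union_of_disjoint]
    exact Finset.disjoint_of_subset_right (Finset.mem_powerset.1 hU) Finset.disjoint_sdiff
  · intro U hU U' hU' hUU
    have h3 : ∀ U ∈ (T \ R).powerset, (R ∪ U) \ R = U := fun U hU => by
      rw [Finset.union_sdiff_left]
      exact Finset.sdiff_eq_self_of_disjoint
        (Finset.disjoint_of_subset_left (Finset.mem_powerset.1 hU) Finset.sdiff_disjoint)
    have hUU' : R ∪ U = R ∪ U' := hUU
    rw [← h3 U hU, hUU', h3 U' hU']

theorem sum_neg_one_pow_between {R T : Finset α} (h : R ⊆ T) :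
    ∑ S ∈ T.powerset with R ⊆ S, (-1 : ℤ) ^ (T.card + S.card) = if R = T then 1 else 0 := by
  rw [sum_between h fun n => (-1 : ℤ) ^ (T.card + n)]
  simp only [← add_assoc, pow_add _ (T.card + R.card)]
  rw [← Finset.mul_sum, Finset.sum_powerset_neg_one_pow_card]
  by_cases hRT : R = T
  · subst hRT
    simp [← two_mul]
  · rw [if_neg hRT, if_neg, mul_zero]
    exact fun h' => hRT (h.antisymm (Finset.sdiff_eq_empty_iff_subset.1 h'))

theorem X_pow_mul_one_add_X_pow {R T : Finset α} (h : R ⊆ T) :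
    (Polynomial.X : ℤ[X]) ^ R.card * (1 + Polynomial.X) ^ (T.card - R.card) =
      ∑ S ∈ T.powerset with R ⊆ S, Polynomial.X ^ S.card := by
  rw [sum_between h fun n => (Polynomial.X : ℤ[X]) ^ n]
  simp only [pow_add]
  rw [← Finset.mul_sum, add_comm, ← Finset.card_sdiff_of_subset h,
    ← Finset.sum_pow_mul_eq_add_pow]
  simp

theorem eq_neg_sum_of_sum_eq (p : Finset α → Prop) [DecidablePred p] (g : Finset α → ℤ)
    {T : Finset α} (hT : p T) (hp : ∀ R S, R ⊆ S → S ⊆ T → p R → p S)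
    (hg : ∀ S ⊆ T, p S → ∑ R ∈ S.powerset with p R, g R = -1) :
    g T = -∑ S ∈ T.powerset with p S, (-1) ^ (T.card + S.card) := by
  have h1 : ∀ S ∈ T.powerset.filter p, (-1 : ℤ) ^ (T.card + S.card) =
      -∑ R ∈ T.powerset.filter p, if R ⊆ S then g R * (-1) ^ (T.card + S.card) else 0 := by
    intro S hS
    rw [Finset.mem_filter, Finset.mem_powerset] at hS
    rw [← Finset.sum_filter, ← Finset.sum_mul]
    have : (T.powerset.filter p).filter (· ⊆ S) = S.powerset.filter p := by
      ext R
      simp only [Finset.mem_filter, Finset.mem_powerset]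
      exact ⟨fun h => ⟨h.2, h.1.2⟩, fun h => ⟨⟨h.1.trans hS.1, h.2⟩, h.1⟩⟩
    rw [this, hg S hS.1 hS.2]
    ring
  rw [Finset.sum_congr rfl h1, Finset.sum_neg_distrib, neg_neg, Finset.sum_comm]
  have h2 : ∀ R ∈ T.powerset.filter p, (∑ S ∈ T.powerset.filter p,
      if R ⊆ S then g R * (-1) ^ (T.card + S.card) else 0) = if R = T then g R else 0 := by
    intro R hR
    rw [Finset.mem_filter, Finset.mem_powerset] at hR
    have : (T.powerset.filter p).filter (R ⊆ ·) = T.powerset.filter (R ⊆ ·) := by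
      ext S
      simp only [Finset.mem_filter, Finset.mem_powerset]
      exact ⟨fun h => ⟨h.1.1, h.2⟩, fun h => ⟨⟨h.1, hp R S h.2 h.1 hR.2⟩, h.2⟩⟩
    rw [← Finset.sum_filter, this, ← Finset.mul_sum, sum_neg_one_pow_between hR.1]
    simp
  rw [Finset.sum_congr rfl h2, Finset.sum_ite_eq', if_pos]
  simp [hT]

end Inversion

section Mobius

variable {α : Type*} (M : Matroid α) [M.Finite] (i : ℕ)

open Classical in
theorem mobius_L (T : LargeSets M i) :
    mobius (L M i) ⊥ (T : L M i) =
      -∑ S ∈ T.1.powerset.filter fun S : Finset α => rank M ≤ rk M (S : Set α) + i,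
        (-1) ^ (T.1.card + S.card) := by
  let _ : Fintype (LargeSets M i) := Fintype.ofFinite _
  let _ : Fintype (L M i) := Fintype.ofFinite _
  let p : Finset α → Prop := fun S => (S : Set α) ⊆ M.E ∧ rank M ≤ rk M (S : Set α) + i
  let g : Finset α → ℤ := fun S => if h : p S then
    mobius (L M i) ⊥ ((⟨S, h⟩ : LargeSets M i) : L M i) else 0
  have hg : ∀ S : LargeSets M i, g S.1 = mobius (L M i) ⊥ (S : L M i) := fun S => dif_pos S.2
  have hbot : mobius (L M i) ⊥ ⊥ = 1 := by
    have := sum_mobius_bot (L M i) ⊥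
    rw [if_pos rfl] at this
    rwa [Finset.sum_eq_single ⊥ (by simp +contextual) (by simp)] at this
  have hsum : ∀ S : LargeSets M i, ∑ R ∈ S.1.powerset with p R, g R = -1 := by
    intro S
    have h : ∑ x : L M i with x ≤ (S : L M i), mobius (L M i) ⊥ x =
        if (S : L M i) = ⊥ then 1 else 0 := by
      convert sum_mobius_bot (L M i) (S : L M i)
    have hsplit : (Finset.univ.filter fun x : L M i => x ≤ (S : L M i)) =
        insert ⊥ ((Finset.univ.filter fun R : LargeSets M i => R ≤ S).map
          ⟨WithBot.some, WithBot.coe_injective⟩) := by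
      ext x
      induction x using WithBot.recBotCoe with
      | bot => simp
      | coe x => simp
    rw [if_neg WithBot.coe_ne_bot, hsplit, Finset.sum_insert (by simp), hbot,
      Finset.sum_map] at h
    simp only [Function.Embedding.coeFn_mk, ← hg] at h
    have h2 : ∑ R ∈ S.1.powerset with p R, g R = ∑ R : LargeSets M i with R ≤ S, g R.1 := by
      refine (Finset.sum_bij (fun R _ => R.1) ?_ ?_ ?_ ?_).symm
      · intro R hR
        exact Finset.mem_filter.2 ⟨Finset.mem_powerset.2 (Finset.mem_filter.1 hR).2, R.2⟩
      · exact fun _ _ _ _ h => Subtype.ext h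
      · intro R hR
        rw [Finset.mem_filter, Finset.mem_powerset] at hR
        exact ⟨⟨R, hR.2⟩, Finset.mem_filter.2 ⟨Finset.mem_univ _, hR.1⟩, rfl⟩
      · exact fun _ _ => rfl
    rw [h2]
    linarith
  rw [← hg, eq_neg_sum_of_sum_eq p g T.2 ?_ fun S _ hS => hsum ⟨S, hS⟩]
  · congr 1
    refine Finset.sum_congr (Finset.filter_congr fun S hS => ?_) fun _ _ => rfl
    refine ⟨And.right, fun h => ⟨?_, h⟩⟩
    exact (Finset.coe_subset.2 (Finset.mem_powerset.1 hS)).trans T.2.1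
  · intro R S hRS hST hR
    exact ⟨(Finset.coe_subset.2 hST).trans T.2.1,
      hR.2.trans (Nat.add_le_add_right (rk_mono M hRS) i)⟩

end Mobius

/-! ### The Whitney homology of the lattices of sets of large rank -/

section Whitney

variable {α : Type*} (M : Matroid α) {i : ℕ}

/-- The open interval below `T`, as a family of finite sets. -/
def intervalEmb (T : LargeSets M i) : Set.Ioo (⊥ : L M i) (T : L M i) ↪o Finset α :=
  OrderEmbedding.ofMapLEIff (fun x => (x.1.unbot x.2.1.ne').1) fun x y => by
    change x.1.unbot x.2.1.ne' ≤ y.1.unbot y.2.1.ne' ↔ _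
    rw [WithBot.unbot_le_iff, WithBot.coe_unbot]
    rfl

theorem range_intervalEmb (T : LargeSets M i) :
    Set.range (intervalEmb M T) = largeBetween M ∅ T.1 (rank M - i) := by
  ext S
  constructor
  · rintro ⟨x, rfl⟩
    have hx := x.2.2
    rw [← WithBot.coe_unbot x.1 x.2.1.ne', WithBot.coe_lt_coe] at hx
    have := (x.1.unbot x.2.1.ne').2.2
    exact ⟨Finset.empty_subset _, hx, Nat.sub_le_iff_le_add.2 this⟩
  · rintro ⟨-, h1, h2⟩
    let S' : LargeSets M i :=
      ⟨S, (Finset.coe_subset.2 h1.1).trans T.2.1, Nat.sub_le_iff_le_add.1 h2⟩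
    exact ⟨⟨(S' : L M i), WithBot.bot_lt_coe _, WithBot.coe_lt_coe.2 h1⟩, rfl⟩

theorem cycles_le_boundaries_interval (T : LargeSets M i) {n : ℕ}
    (hn : n < T.1.card - (rank M - i)) :
    cycles (Set.Ioo (⊥ : L M i) (T : L M i)) n ≤
      boundaries (Set.Ioo (⊥ : L M i) (T : L M i)) n := by
  classical
  obtain ⟨lt, hlt, hlt'⟩ := exists_isStrictTotalOrder (Finset α)
  refine cycles_le_boundaries (intervalEmb M T) lt hlt' ?_ hn
  rw [range_intervalEmb]
  exact acyclicBelow_largeBetween M _ rfl (by simp) (Finset.empty_subset _) (by simp)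
    (Nat.sub_le_iff_le_add.2 T.2.2)

theorem isEmpty_chains_interval (T : LargeSets M i) {n : ℕ}
    (hn : T.1.card - (rank M - i) < n) :
    IsEmpty (Fin n ↪o Set.Ioo (⊥ : L M i) (T : L M i)) := by
  refine ⟨fun c => ?_⟩
  have hmem : ∀ k, intervalEmb M T (c k) ∈ largeBetween M ∅ T.1 (rank M - i) := fun k =>
    range_intervalEmb M T ▸ Set.mem_range_self (c k)
  have hmono : StrictMono fun k => (intervalEmb M T (c k)).card := fun k l hkl =>
    Finset.card_lt_card ((intervalEmb M T).strictMono (c.strictMono hkl))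
  have := Finset.card_le_card_of_injOn (s := Finset.univ) (t := Finset.Ico (rank M - i) T.1.card)
    (fun k => (intervalEmb M T (c k)).card) (fun k _ => ?_) hmono.injective.injOn
  · simp at this
    omega
  · simpa using ⟨Nat.sub_le_iff_le_add.1 ((hmem k).2.2.trans (rk_le_card M _)),
      Finset.card_lt_card (hmem k).2.1⟩

variable [M.Finite]

theorem free_finite_reducedHomology_interval (T : LargeSets M i) (n : ℕ) :
    Module.Free ℤ (ReducedHomology (Set.Ioo (⊥ : L M i) (T : L M i)) n) ∧
    Module.Finite ℤ (ReducedHomology (Set.Ioo (⊥ : L M i) (T : L M i)) n) := by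
  by_cases hn : n < T.1.card - (rank M - i)
  · have := subsingleton_reducedHomology _ (cycles_le_boundaries_interval M T hn)
    exact ⟨inferInstance, inferInstance⟩
  · have := isEmpty_chains_interval M T (n := n + 1) (by omega)
    exact ⟨Module.Free.of_equiv (reducedHomologyEquivCycles _ n).symm,
      Module.Finite.equiv (reducedHomologyEquivCycles _ n).symm⟩

theorem finrank_reducedHomology_interval (T : LargeSets M i) (n : ℕ) :
    (Module.finrank ℤ (ReducedHomology (Set.Ioo (⊥ : L M i) (T : L M i)) n) : ℤ) =
      if T.1.card - (rank M - i) = n then (-1) ^ (n + 1) * mobius (L M i) ⊥ (T : L M i) else 0 := by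
  split_ifs with h
  · have hemp := isEmpty_chains_interval M T (n := n + 1) (by omega)
    have _ := Fintype.ofFinite (L M i)
    rw [(reducedHomologyEquivCycles _ n).finrank_eq,
      finrank_cycles _ fun k hk => cycles_le_boundaries_interval M T (hk.trans_eq h.symm),
      sum_card_chains (n + 1) _ (WithBot.bot_lt_coe T) hemp]
    ring
  · rcases lt_or_gt_of_ne h with h | h
    · have hemp := isEmpty_chains_interval M T (n := n + 1) (by omega)
      have hemp' := isEmpty_chains_interval M T h
      rw [(reducedHomologyEquivCycles _ n).finrank_eq]
      have : Subsingleton (Chains (Set.Ioo (⊥ : L M i) (T : L M i)) n) := inferInstance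
      simp [Module.finrank_zero_of_subsingleton]
    · have := subsingleton_reducedHomology _ (cycles_le_boundaries_interval M T h)
      simp [Module.finrank_zero_of_subsingleton]

theorem whitneyNumber_eq_finrank {j : ℕ} (hi : i ≤ rank M) (hj : 1 ≤ j) :
    whitneyNumber M i j = (Module.finrank ℤ (WhitneyHomology (L M i) (j - 1)) : ℤ) := by
  classical
  let _ : Fintype (LargeSets M i) := Fintype.ofFinite _
  have _ : Fintype {σ : L M i // ⊥ < σ} := Fintype.ofFinite _
  have hex : ∀ σ : {σ : L M i // ⊥ < σ}, ∃ T : LargeSets M i, (T : L M i) = σ.1 := fun σ =>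
    WithBot.ne_bot_iff_exists.1 σ.2.ne'
  have hff : ∀ σ : {σ : L M i // ⊥ < σ},
      Module.Free ℤ (ReducedHomology (Set.Ioo (⊥ : L M i) σ.1) (j - 1)) ∧
      Module.Finite ℤ (ReducedHomology (Set.Ioo (⊥ : L M i) σ.1) (j - 1)) := fun σ => by
    obtain ⟨T, hT⟩ := hex σ
    rw [← hT]
    exact free_finite_reducedHomology_interval M T (j - 1)
  have _ := fun σ => (hff σ).1
  have _ := fun σ => (hff σ).2
  rw [Module.finrank_directSum, Nat.cast_sum]
  have hbij : Function.Bijective fun T : LargeSets M i =>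
      (⟨(T : L M i), WithBot.bot_lt_coe T⟩ : {σ : L M i // ⊥ < σ}) :=
    ⟨fun S T h => WithBot.coe_injective (congrArg Subtype.val h), fun σ => by
      obtain ⟨T, hT⟩ := hex σ
      exact ⟨T, Subtype.ext hT⟩⟩
  rw [← hbij.sum_comp]
  simp only [finrank_reducedHomology_interval, Nat.sub_add_cancel hj]
  rw [whitneyNumber, ← Finset.sum_filter, Finset.mul_sum]
  refine Finset.sum_congr (Finset.filter_congr fun S _ => ?_) fun _ _ => rfl
  have h1 := S.2.2
  have h2 := rk_le_card M S.1
  omega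

end Whitney

/-! ### The polynomial `Ŷ_M` -/

section Polynomials

variable {α : Type*} (M : Matroid α) [M.Finite]

theorem coe_ground : (ground M : Set α) = M.E := by
  simp [ground]

theorem rk_ground : rk M (ground M : Set α) = rank M := by
  rw [coe_ground, rank]

theorem Y_eq_sum {K : Type*} [Field K] {q : K} (hq : q ≠ 0) (hq' : 1 - q ≠ 0) (t : K) :
    Y M q t = ∑ S ∈ (ground M).powerset,
      t ^ (rank M - rk M (S : Set α)) *
        ((1 - q) ^ S.card * q ^ ((ground M).card - S.card)) := by
  simp only [Y, tuttePolynomial, map_sum, map_mul, map_pow, map_sub, MvPolynomial.aeval_X,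
    map_one, Finset.mul_sum, corank, rk_ground]
  refine Finset.sum_congr rfl fun S hS => ?_
  have hS' := Finset.mem_powerset.1 hS
  have h1 : rk M (S : Set α) ≤ rank M := rk_ground M ▸ rk_mono M hS'
  have h2 := rk_le_card M S
  have h3 := Finset.card_le_card hS'
  have h4 := rk_le_card M (ground M)
  rw [rk_ground] at h4
  obtain ⟨a, ha⟩ := Nat.exists_eq_add_of_le h1
  obtain ⟨b, hb⟩ := Nat.exists_eq_add_of_le h2
  obtain ⟨c, hc⟩ := Nat.exists_eq_add_of_le h3
  obtain ⟨e, he⟩ := Nat.exists_eq_add_of_le h4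
  have hab : e + a = b + c := by omega
  have e1 : rank M - rk M (S : Set α) = a := by omega
  have e2 : S.card - rk M (S : Set α) = b := by omega
  have e3 : (ground M).card - S.card = c := by omega
  have e4 : (ground M).card - rank M = e := by omega
  rw [e1, e2, e3, e4, ha, hb]
  have x1 : (q * t + 1 - q) / (1 - q) - 1 = q * t / (1 - q) := by
    field_simp
    ring
  have x2 : 1 / q - 1 = (1 - q) / q := by field_simp
  have x3 : q ^ e * q ^ a = q ^ b * q ^ c := by rw [← pow_add, ← pow_add, hab]
  simp only [Matrix.cons_val_zero, Matrix.cons_val_one, x1, x2, div_pow, mul_pow, pow_add]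
  field_simp
  linear_combination t ^ a * x3

/-- The coefficient polynomial `(-p) ^ #S * (1 + p) ^ (m - #S)`. -/
noncomputable def weight (S : Finset α) : ℤ[X] :=
  (-Polynomial.X) ^ S.card * (1 + Polynomial.X) ^ ((ground M).card - S.card)

/-- `Ŷ_M(p, t)` as a polynomial. -/
noncomputable def YhatPoly : ℤ[X][X] :=
  ∑ S ∈ (ground M).powerset, Polynomial.C (weight M S) *
    ∑ k ∈ Finset.Ico (rank M - rk M (S : Set α)) (rank M),
      Polynomial.C ((-1) ^ (rank M + k)) * Polynomial.X ^ k

theorem sum_weight : ∑ S ∈ (ground M).powerset, weight M S = 1 := by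
  simp only [weight]
  rw [Finset.sum_pow_mul_eq_add_pow]
  simp

theorem alternating_geom_sum {R : Type*} [CommRing R] (x : R) (r d : ℕ) :
    (∑ k ∈ Finset.Ico (d - r) d, (-1) ^ (d + k) * x ^ k) * (1 + x) =
      (-1) ^ d * (-x) ^ (d - r) - x ^ d := by
  have h1 : ∀ k, (-1) ^ (d + k) * x ^ k * (1 + x) =
      -((-1) ^ (d + (k + 1)) * x ^ (k + 1) - (-1) ^ (d + k) * x ^ k) := fun k => by ring
  rw [Finset.sum_mul, Finset.sum_congr rfl fun k _ => h1 k, Finset.sum_neg_distrib,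
    Finset.sum_Ico_sub (fun k => (-1) ^ (d + k) * x ^ k) (Nat.sub_le d r), ← two_mul, pow_mul]
  simp only [neg_pow x, pow_add, even_two, Even.neg_pow, one_pow]
  ring

theorem YhatPoly_mul :
    YhatPoly M * (1 + Polynomial.X) =
      (-1) ^ rank M * ∑ S ∈ (ground M).powerset,
        (-Polynomial.X) ^ (rank M - rk M (S : Set α)) * Polynomial.C (weight M S) -
        Polynomial.X ^ rank M := by
  have h : ∀ S ∈ (ground M).powerset, Polynomial.C (weight M S) *
      (∑ k ∈ Finset.Ico (rank M - rk M (S : Set α)) (rank M),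
        Polynomial.C ((-1) ^ (rank M + k)) * Polynomial.X ^ k) * (1 + Polynomial.X) =
      (-1) ^ rank M * ((-Polynomial.X) ^ (rank M - rk M (S : Set α)) *
        Polynomial.C (weight M S)) - Polynomial.C (weight M S) * Polynomial.X ^ rank M := by
    intro S _
    have := alternating_geom_sum (Polynomial.X : ℤ[X][X]) (rk M (S : Set α)) (rank M)
    simp only [map_pow, map_neg, map_one]
    rw [mul_assoc, this]
    ring
  rw [YhatPoly, Finset.sum_mul, Finset.sum_congr rfl h, Finset.sum_sub_distrib, ← Finset.sum_mul,
    ← map_sum, sum_weight, ← Finset.mul_sum]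
  simp

theorem algebraMap_YhatPoly : algebraMap ℤ[X][X] RatPT (YhatPoly M) = Yhat M := by
  have hinj := IsFractionRing.injective ℤ[X][X] RatPT
  have hp : (1 : RatPT) + pVar = algebraMap ℤ[X][X] RatPT (Polynomial.C (1 + Polynomial.X)) := by
    simp [pVar]
  have ht : (1 : RatPT) + tVar = algebraMap ℤ[X][X] RatPT (1 + Polynomial.X) := by
    simp [tVar]
  have hne : (1 + Polynomial.X : ℤ[X]) ≠ 0 := by
    rw [add_comm]
    exact Polynomial.X_add_C_ne_zero 1
  have hne' : (1 + Polynomial.X : ℤ[X][X]) ≠ 0 := by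
    rw [add_comm]
    exact Polynomial.X_add_C_ne_zero 1
  have hq : (1 : RatPT) + pVar ≠ 0 := by
    rw [hp, Ne, map_eq_zero_iff _ hinj, Polynomial.C_eq_zero]
    exact hne
  have hq1 : (1 : RatPT) - (1 + pVar) =
      algebraMap ℤ[X][X] RatPT (Polynomial.C (-Polynomial.X)) := by
    simp [pVar]
  have hq' : (1 : RatPT) - (1 + pVar) ≠ 0 := by
    rw [hq1, Ne, map_eq_zero_iff _ hinj, Polynomial.C_eq_zero, neg_eq_zero]
    exact Polynomial.X_ne_zero
  have ht' : (1 : RatPT) + tVar ≠ 0 := by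
    rw [ht, Ne, map_eq_zero_iff _ hinj]
    exact hne'
  rw [Yhat, eq_div_iff ht', Y_eq_sum M hq hq', hq1, hp, ht, ← map_mul, YhatPoly_mul]
  simp only [map_sub, map_mul, map_pow, map_neg, map_one, map_sum, weight, tVar]

theorem coeff_YhatPoly [DecidableEq α] {i : ℕ} (hi : i < rank M) (n : ℕ) :
    ((YhatPoly M).coeff i).coeff n = (-1) ^ (rank M + i) *
      ∑ S ∈ (ground M).powerset, if rank M ≤ rk M (S : Set α) + i then
        (-1) ^ S.card * ∑ T ∈ (ground M).powerset with S ⊆ T, (if T.card = n then 1 else 0)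
      else 0 := by
  rw [YhatPoly, Polynomial.finsetSum_coeff, Polynomial.finsetSum_coeff, Finset.mul_sum]
  refine Finset.sum_congr rfl fun S hS => ?_
  have hw : weight M S = Polynomial.C ((-1) ^ S.card) *
      ∑ T ∈ (ground M).powerset with S ⊆ T, Polynomial.X ^ T.card := by
    rw [← X_pow_mul_one_add_X_pow (Finset.mem_powerset.1 hS), weight, neg_pow]
    simp [mul_assoc]
  rw [Polynomial.coeff_C_mul, Polynomial.finsetSum_coeff]
  simp only [Polynomial.coeff_C_mul_X_pow]
  rw [Finset.sum_ite_eq]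
  simp only [Finset.mem_Ico, hi, and_true, Nat.sub_le_iff_le_add']
  split_ifs with h
  · have : ((-1 : ℤ[X]) ^ (rank M + i)) = Polynomial.C ((-1) ^ (rank M + i)) := by simp
    rw [this, mul_comm, Polynomial.coeff_C_mul, hw, Polynomial.coeff_C_mul,
      Polynomial.finsetSum_coeff]
    simp only [Polynomial.coeff_X_pow, eq_comm (a := n)]
  · simp

open Classical in
theorem whitneyNumber_eq_sum (i j : ℕ) :
    whitneyNumber M i j = (-1) ^ j * ∑ T ∈ (ground M).powerset with T.card + 1 + i = j + rank M,
      -∑ S ∈ T.powerset.filter fun S : Finset α => rank M ≤ rk M (S : Set α) + i,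
        (-1 : ℤ) ^ (T.card + S.card) := by
  let _ : Fintype (LargeSets M i) := Fintype.ofFinite _
  rw [whitneyNumber]
  congr 1
  simp only [mobius_L]
  refine Finset.sum_bij_ne_zero (fun T _ _ => T.1) ?_ ?_ ?_ ?_
  · intro T hT _
    refine Finset.mem_filter.2 ⟨Finset.mem_powerset.2 ?_, (Finset.mem_filter.1 hT).2⟩
    rw [← Finset.coe_subset, coe_ground]
    exact T.2.1
  · exact fun _ _ _ _ _ _ h => Subtype.ext h
  · intro T hT hne
    obtain ⟨S, hS, -⟩ := Finset.exists_ne_zero_of_sum_ne_zero (neg_ne_zero.1 hne)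
    rw [Finset.mem_filter, Finset.mem_powerset] at hS hT
    refine ⟨⟨T, ?_, hS.2.trans (Nat.add_le_add_right (rk_mono M hS.1) i)⟩,
      Finset.mem_filter.2 ⟨Finset.mem_univ _, hT.2⟩, hne, rfl⟩
    rw [← coe_ground, Finset.coe_subset]
    exact hT.1
  · exact fun _ _ _ => rfl

theorem coeff_YhatPoly_eq_whitneyNumber {i j : ℕ} (hi : i < rank M) :
    ((YhatPoly M).coeff i).coeff (rank M - 1 - i + j) = whitneyNumber M i j := by
  classical
  rw [coeff_YhatPoly M hi, whitneyNumber_eq_sum, Finset.mul_sum, Finset.mul_sum]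
  have h1 : ∀ S ∈ (ground M).powerset, ((-1 : ℤ) ^ (rank M + i) *
      if rank M ≤ rk M (S : Set α) + i then
        (-1) ^ S.card * ∑ T ∈ (ground M).powerset with S ⊆ T,
          (if T.card = rank M - 1 - i + j then 1 else 0)
      else 0) = ∑ T ∈ (ground M).powerset with T.card + 1 + i = j + rank M,
        if S ⊆ T ∧ rank M ≤ rk M (S : Set α) + i then
          (-1) ^ j * -(-1) ^ (T.card + S.card) else 0 := by
    intro S _
    split_ifs with h
    · rw [Finset.sum_filter, Finset.sum_filter, Finset.mul_sum, Finset.mul_sum]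
      refine Finset.sum_congr rfl fun T _ => ?_
      by_cases hT : T.card + 1 + i = j + rank M
      · have hT' : T.card = rank M - 1 - i + j := by omega
        by_cases hST : S ⊆ T
        · rw [if_pos hT]
          simp only [hT', hST, h, if_true, and_true, mul_one]
          obtain ⟨a, ha⟩ := Nat.exists_eq_add_of_lt hi
          have ha' : rank M - 1 - i = a := by omega
          rw [ha', ha]
          have e1 : (-1 : ℤ) ^ i * (-1) ^ i = 1 := by rw [← mul_pow]; simp
          have e2 : (-1 : ℤ) ^ j * (-1) ^ j = 1 := by rw [← mul_pow]; simp
          simp only [pow_add, pow_one]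
          linear_combination (-(-1 : ℤ) ^ a * (-1) ^ S.card) * e1 +
            ((-1 : ℤ) ^ a * (-1) ^ S.card) * e2
        · simp [hST]
      · have hT' : T.card ≠ rank M - 1 - i + j := by omega
        simp [hT, hT']
    · simp [h]
  rw [Finset.sum_congr rfl h1, Finset.sum_comm]
  refine Finset.sum_congr rfl fun T hT => ?_
  rw [← Finset.sum_filter, ← Finset.sum_neg_distrib, Finset.mul_sum]
  refine Finset.sum_congr ?_ fun _ _ => rfl
  have hTE := Finset.mem_powerset.1 (Finset.mem_filter.1 hT).1
  ext S
  simp only [Finset.mem_filter, Finset.mem_powerset]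
  exact ⟨fun h => h.2, fun h => ⟨h.1.trans hTE, h⟩⟩

end Polynomials

end TutteWhitney

open TutteWhitney in
theorem theorem3p1 {α : Type*} (M : Matroid α) [M.Finite] [M.Loopless] (d m : ℕ)
    (hd : TutteWhitney.rank M = d) (hm : M.E.ncard = m) (hd1 : 1 ≤ d) :
    ∃ F : Polynomial (Polynomial ℤ),
      algebraMap (Polynomial (Polynomial ℤ)) RatPT F = Yhat M ∧
      ∀ i j : ℕ, i ≤ d - 1 → 1 ≤ j → j ≤ m - d + 1 + i →
        (F.coeff i).coeff (d - 1 - i + j) = whitneyNumber M i j ∧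
        whitneyNumber M i j = (Module.finrank ℤ (WhitneyHomology (L M i) (j - 1)) : ℤ) := by
  subst hd
  refine ⟨YhatPoly M, algebraMap_YhatPoly M, fun i j hi hj _ => ⟨?_, ?_⟩⟩
  · exact coeff_YhatPoly_eq_whitneyNumber M (by omega)
  · exact whitneyNumber_eq_finrank M (by omega) hj
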